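/- Let $f:X\times Y\to\{0,1\}$. A finite set $F\subseteq X\times Y$ is a 1-fooling set for $f$ if $f(x,y)=1$ for all $(x,y)\in F$ and, for any two distinct pairs $(x,y),(x',y')\in F$, $f(x,y')=0$ or $f(x',y)=0$. It is upper-triangular if it has a total order such that $(x,y)>(x',y')$ implies $f(x,y')=0$ (after renaming Bob's inputs so that $F=\{(x,x)\}$: there is a total order on the $x$'s such that $x>y$ implies $f(x,y)=0$). A $q$-qubit protocol with prior entanglement ($q\ge 1$) is as follows. Alice, who knows $x\in X$, and Bob, who knows $y\in Y$, hold finitely many qubits each (any numbers), jointly in an arbitrary pure state that does not depend on the inputs. They exchange $q$ qubits one at a time, the sender of each being fixed in advance. Before sending, the sender applies a unitary, which may depend on the sender's own input, to all qubits in the sender's possession. The last qubit sent is measured in the computational basis and the result is the output. Let $Q_1^*(f)$ be the least $q$ for which there is such a protocol that outputs 0 with certainty whenever $f(x,y)=0$, and outputs 1 with probability at least $1/2$ whenever $f(x,y)=1$ ($Q_1^*(f)=\infty$ if there is none). Theorem. If $f$ has an upper-triangular 1-fooling set of size $N$, then $$Q_1^*(f)\ \ge\ \tfrac12\log_2 N-\tfrac12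 .$$ -/

import Mathlib

namespace QuantumComm

universe u v

section FoolingSets

variable {X : Type u} {Y : Type v}

/-- `F` is a 1-fooling set for `f`: `f` takes the value 1 on `F`, and for any two different
pairs of `F` at least one of the two crossed pairs is a 0-input. -/
def IsOneFoolingSet (f : X × Y → Bool) (F : Finset (X × Y)) : Prop :=
  (∀ p ∈ F, f p = true) ∧
    ∀ p ∈ F, ∀ p' ∈ F, p ≠ p' → f (p.1, p'.2) = false ∨ f (p'.1, p.2) = false

/-- A 1-fooling set is upper-triangular if its elements can be totally ordered in such a way
that `p > p'` implies `f (x, y') = 0`, where `p = (x, y)` and `p' = (x', y')`. -/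
def IsUpperTriangularOneFoolingSet (f : X × Y → Bool) (F : Finset (X × Y)) : Prop :=
  IsOneFoolingSet f F ∧
    ∃ _ : LinearOrder {p : X × Y // p ∈ F},
      ∀ p p' : {p : X × Y // p ∈ F}, p > p' → f (p.val.1, p'.val.2) = false

end FoolingSets

section States

/-- The computational basis of a register of `m` qubits (`true` stands for the bit 1). -/
abbrev Basis (m : ℕ) : Type := Fin m → Bool

/-- A vector of the joint space of Alice's `m` qubits and Bob's `n` qubits, given by its
amplitudes: `ψ u v` is the coefficient of `|u⟩ ⊗ |v⟩`. -/
abbrev JointVector (m n : ℕ) : Type := Basis m → Basis n → ℂ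

/-- The unitary operations on `m` qubits. -/
abbrev QubitUnitary (m : ℕ) : Type := Matrix.unitaryGroup (Basis m) ℂ

variable {m n : ℕ}

/-- The squared Euclidean norm. -/
noncomputable def JointVector.normSq (ψ : JointVector m n) : ℝ :=
  ∑ u, ∑ v, ‖ψ u v‖ ^ 2

/-- `(U ⊗ I) ψ`: Alice applies `U` to her register. -/
noncomputable def JointVector.applyAlice (U : QubitUnitary m) (ψ : JointVector m n) :
    JointVector m n :=
  fun u v => ∑ u', U.val u u' * ψ u' v

/-- `(I ⊗ V) ψ`: Bob applies `V` to his register. -/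
noncomputable def JointVector.applyBob (V : QubitUnitary n) (ψ : JointVector m n) :
    JointVector m n :=
  fun u v => ∑ v', V.val v v' * ψ u v'

/-- The first qubit of Alice is handed over to Bob and becomes his first qubit. -/
def JointVector.aliceToBob (ψ : JointVector (m + 1) n) : JointVector m (n + 1) :=
  fun u v => ψ (Fin.cons (v 0) u) (Fin.tail v)

/-- The first qubit of Bob is handed over to Alice and becomes her first qubit. -/
def JointVector.bobToAlice (ψ : JointVector m (n + 1)) : JointVector (m + 1) n :=
  fun u v => ψ (Fin.tail u) (Fin.cons (u 0) v)

end States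

/-- `Dialogue X Y m n q`: what two parties, Alice with input in `X` and `m` qubits and Bob with
input in `Y` and `n` qubits, do when they exchange `q` further qubits, `q ≥ 1`.  One qubit is
sent at a time: the sender applies a unitary, which may depend on the sender's own input, to all
the qubits in the sender's possession, and then puts the first of them on the channel.  Who sends
which qubit is fixed in advance, in any order (so a message may consist of many qubits, and
nobody has to speak in turn).  The last qubit on the channel is measured in the computational
basis, which gives the output of the protocol. -/
inductive Dialogue (X : Type u) (Y : Type v) : ℕ → ℕ → ℕ → Type (max u v)
  /-- Alice sends the last qubit, which is measured. -/
  | aliceLast {m n : ℕ} (U : X → QubitUnitary (m + 1)) : Dialogue X Y (m + 1) n 1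
  /-- Bob sends the last qubit, which is measured. -/
  | bobLast {m n : ℕ} (V : Y → QubitUnitary (n + 1)) : Dialogue X Y m (n + 1) 1
  /-- Alice sends a qubit to Bob, and they go on. -/
  | aliceSends {m n q : ℕ} (U : X → QubitUnitary (m + 1)) (next : Dialogue X Y m (n + 1) q) :
      Dialogue X Y (m + 1) n (q + 1)
  /-- Bob sends a qubit to Alice, and they go on. -/
  | bobSends {m n q : ℕ} (V : Y → QubitUnitary (n + 1)) (next : Dialogue X Y (m + 1) n q) :
      Dialogue X Y m (n + 1) (q + 1)

/-- The probability that the output is 1, on inputs `x` and `y` and from the joint state `ψ`. -/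
noncomputable def Dialogue.probOne {X : Type u} {Y : Type v} (x : X) (y : Y) :
    {m n q : ℕ} → Dialogue X Y m n q → JointVector m n → ℝ
  | _, _, _, .aliceLast U, ψ => ∑ u, ∑ v, ‖(ψ.applyAlice (U x)) (Fin.cons true u) v‖ ^ 2
  | _, _, _, .bobLast V, ψ => ∑ u, ∑ v, ‖(ψ.applyBob (V y)) u (Fin.cons true v)‖ ^ 2
  | _, _, _, .aliceSends U next, ψ => next.probOne x y (ψ.applyAlice (U x)).aliceToBob
  | _, _, _, .bobSends V next, ψ => next.probOne x y (ψ.applyBob (V y)).bobToAlice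

/-- A quantum communication protocol with prior entanglement and `q` qubits of communication.
Alice and Bob start with any numbers of qubits, in any joint unit vector that does not depend on
the inputs (it contains the prior entanglement and all the blank workspace). -/
structure EntangledProtocol (X : Type u) (Y : Type v) (q : ℕ) where
  /-- the number of qubits that Alice holds at the start -/
  aliceQubits : ℕ
  /-- the number of qubits that Bob holds at the start -/
  bobQubits : ℕ
  /-- the shared starting state -/
  start : JointVector aliceQubits bobQubits
  start_normSq : start.normSq = 1
  /-- the local operations and the messages -/
  dialogue : Dialogue X Y aliceQubits bobQubits q

section Complexity

variable {X : Type u} {Y : Type v}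

/-- The probability that the protocol outputs 1 on inputs `x` and `y`. -/
noncomputable def EntangledProtocol.probOne {q : ℕ} (P : EntangledProtocol X Y q)
    (x : X) (y : Y) : ℝ :=
  P.dialogue.probOne x y P.start

/-- The protocol computes `f` with one-sided error: it always outputs 0 on 0-inputs, and it
outputs 1 with probability at least `1 / 2` on 1-inputs. -/
def EntangledProtocol.ComputesOneSided {q : ℕ} (P : EntangledProtocol X Y q)
    (f : X × Y → Bool) : Prop :=
  ∀ x y, (f (x, y) = false → P.probOne x y = 0) ∧ (f (x, y) = true → 1 / 2 ≤ P.probOne x y)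

/-- The one-sided-error quantum communication complexity of `f` with prior entanglement: the
least number of qubits communicated by a protocol that computes `f` with one-sided error (`⊤` if
there is no such protocol, which cannot happen when one of `X`, `Y` is finite). -/
noncomputable def oneSidedComplexity (f : X × Y → Bool) : ℕ∞ :=
  sInf {c : ℕ∞ | ∃ (q : ℕ) (P : EntangledProtocol X Y q), P.ComputesOneSided f ∧ c = q}

end Complexity

end QuantumComm

/-!
The idea is that communication can be traded for post-selection, after which Bob, sharing only
entanglement with Alice, would learn too much about her input.

Think of `q` qubits that are teleported, with the classical messages of the teleportation guessed
instead of sent. All guesses are right with probability `4 ^ (-q)`, so that Alice and Bob, by local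
operations on a shared state and without communication, both accept with probability
`4 ^ (-q) * P(x, y)`, where `P` is the probability of output 1 in the protocol. Here this is done
algebraically (`Dialogue.exists_postSelection`): the final amplitudes are a sum over the histories
`t` of the qubits sent, with terms that are products of an operator of Alice and one of Bob, and
such a sum is what local operators produce from a maximally entangled state indexed by `t`.
Sending a qubit doubles the squared operator norm of the sender's part (`NormSqLE.sendMatrix`),
receiving one leaves the receiver's part bounded as before (`NormSqLE.receiveMatrix`), and the
number of histories doubles too, which gives the factor 4 per qubit.

Now let `x` range over an upper-triangular fooling set, and let Bob perform his tests one after the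
other in increasing order. If Alice has `x`, the tests for `y < x` accept with probability 0, hence
leave the state undisturbed, and the test for `x` then accepts, jointly with Alice, with probability
at least `4 ^ (-q) / 2`. By no-signalling, the distribution of Bob's first success does not depend
on `x`, and so `N * 4 ^ (-q) / 2 ≤ 1` (`card_mul_le_of_tests`). The sequence of tests is encoded by
the mutually orthogonal subspaces `firstDetected`.
-/

namespace QuantumComm

/-! ### Matrices bounded in operator norm -/

section Bounded

variable {R I : Type*} [Fintype R] [Fintype I]

/-- The squared operator norm of `A`, for the Euclidean norms, is at most `α`. -/
def NormSqLE (A : Matrix R I ℂ) (α : ℝ) : Prop :=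
  ∀ c : I → ℂ, ∑ r, ‖∑ i, A r i * c i‖ ^ 2 ≤ α * ∑ i, ‖c i‖ ^ 2

/-- The bound on `A` persists when the coordinates acted on are vectors, that is, for `A ⊗ 1`. -/
theorem NormSqLE.sum_norm_sum_smul_sq_le {J : Type*} [Fintype J] {A : Matrix R I ℂ} {α : ℝ}
    (hA : NormSqLE A α) (v : I → EuclideanSpace ℂ J) :
    ∑ r, ‖∑ i, A r i • v i‖ ^ 2 ≤ α * ∑ i, ‖v i‖ ^ 2 := by
  simp only [EuclideanSpace.norm_sq_eq]
  rw [Finset.sum_comm, Finset.sum_comm (s := (Finset.univ : Finset I)), Finset.mul_sum]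
  refine Finset.sum_le_sum fun j _ => ?_
  simpa using hA fun i => v i j

theorem sum_norm_sq_unitary [DecidableEq I] (U : Matrix.unitaryGroup I ℂ) (c : I → ℂ) :
    ∑ r, ‖∑ i, U.val r i * c i‖ ^ 2 = ∑ i, ‖c i‖ ^ 2 := by
  have key : star (U.val.mulVec c) ⬝ᵥ U.val.mulVec c = star c ⬝ᵥ c := by
    rw [Matrix.star_mulVec, Matrix.dotProduct_mulVec, Matrix.vecMul_vecMul,
      ← Matrix.star_eq_conjTranspose, Matrix.UnitaryGroup.star_mul_self, Matrix.vecMul_one]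
  have expand {K : Type _} [Fintype K] (d : K → ℂ) :
      star d ⬝ᵥ d = ((∑ i, ‖d i‖ ^ 2 : ℝ) : ℂ) := by
    simp [dotProduct, Complex.conj_mul']
  rw [expand, expand] at key
  exact_mod_cast key

end Bounded

/-! ### Identification of one of several ordered inputs by local tests -/

section Identification

open Submodule

variable {ι J S : Type*} [LinearOrder ι] [Fintype J]

/-- The vectors that pass the test `B x` with nonzero amplitude after having failed all the
earlier tests: the joint kernel of the `B y` with `y < x`, minus (orthogonally) the joint kernel
of the `B y` with `y ≤ x`. -/
noncomputable def firstDetected (B : ι → EuclideanSpace ℂ J →ₗ[ℂ] EuclideanSpace ℂ S) (x : ι) :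
    Submodule ℂ (EuclideanSpace ℂ J) :=
  (⨅ y, ⨅ _ : y < x, (B y).ker) ⊓ (⨅ y, ⨅ _ : y ≤ x, (B y).ker)ᗮ

variable (B : ι → EuclideanSpace ℂ J →ₗ[ℂ] EuclideanSpace ℂ S)

theorem inner_eq_zero_of_mem_firstDetected_of_lt {x y : ι} (hxy : x < y)
    {v w : EuclideanSpace ℂ J} (hv : v ∈ firstDetected B x) (hw : w ∈ firstDetected B y) :
    inner ℂ v w = 0 := by
  refine inner_left_of_mem_orthogonal (K := ⨅ z, ⨅ _ : z ≤ x, (B z).ker) ?_ (mem_inf.1 hv).2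
  have hw' := (mem_inf.1 hw).1
  simp only [Submodule.mem_iInf] at hw' ⊢
  exact fun z hz => hw' z (hz.trans_lt hxy)

theorem inner_eq_zero_of_mem_firstDetected {x y : ι} (hxy : x ≠ y)
    {v w : EuclideanSpace ℂ J} (hv : v ∈ firstDetected B x) (hw : w ∈ firstDetected B y) :
    inner ℂ v w = 0 := by
  rcases hxy.lt_or_gt with h | h
  · exact inner_eq_zero_of_mem_firstDetected_of_lt B h hv hw
  · exact inner_eq_zero_symm.1 (inner_eq_zero_of_mem_firstDetected_of_lt B h hw hv)

/-- Bessel's inequality for the mutually orthogonal subspaces `firstDetected B x`. -/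
theorem sum_norm_sq_starProjection_firstDetected_le [Fintype ι] (v : EuclideanSpace ℂ J) :
    ∑ x, ‖(firstDetected B x).starProjection v‖ ^ 2 ≤ ‖v‖ ^ 2 := by
  have hsum : ‖∑ x, (firstDetected B x).starProjection v‖ ^ 2 =
      ∑ x, ‖(firstDetected B x).starProjection v‖ ^ 2 := by
    have h : inner ℂ (∑ x, (firstDetected B x).starProjection v)
        (∑ x, (firstDetected B x).starProjection v) =
        ∑ x, inner ℂ ((firstDetected B x).starProjection v)
          ((firstDetected B x).starProjection v) := by
      rw [sum_inner]
      refine Finset.sum_congr rfl fun x _ => ?_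
      rw [inner_sum]
      refine Finset.sum_eq_single x (fun y _ hyx => ?_) (by simp)
      exact inner_eq_zero_of_mem_firstDetected B hyx.symm (starProjection_apply_mem _ _)
        (starProjection_apply_mem _ _)
    simp only [inner_self_eq_norm_sq_to_K] at h
    exact_mod_cast h
  have hinner : RCLike.re (inner ℂ v (∑ x, (firstDetected B x).starProjection v)) =
      ∑ x, ‖(firstDetected B x).starProjection v‖ ^ 2 := by
    rw [inner_sum, map_sum]
    refine Finset.sum_congr rfl fun x _ => ?_
    rw [← inner_starProjection_left_eq_right]
    exact re_inner_starProjection_eq_normSq _ v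
  have h := norm_sub_sq (𝕜 := ℂ) v (∑ x, (firstDetected B x).starProjection v)
  rw [hinner, hsum] at h
  nlinarith [sq_nonneg ‖v - ∑ x, (firstDetected B x).starProjection v‖]

/-- A vector that fails all the tests before `x` passes the test `x` with the same amplitude as
its component in `firstDetected B x`. -/
theorem apply_starProjection_firstDetected {x : ι} {v : EuclideanSpace ℂ J}
    (hv : ∀ y < x, B y v = 0) : B x ((firstDetected B x).starProjection v) = B x v := by
  set L := ⨅ y, ⨅ _ : y ≤ x, (B y).ker with hL
  have hLker : ∀ w ∈ L, ∀ y ≤ x, B y w = 0 := by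
    intro w hw y hy
    simp only [hL, Submodule.mem_iInf] at hw
    exact hw y hy
  have hproj : (firstDetected B x).starProjection v = v - L.starProjection v := by
    refine (eq_starProjection_of_mem_orthogonal' (z := L.starProjection v) ?_ ?_ (by simp))
    · refine mem_inf.2 ⟨?_, sub_starProjection_mem_orthogonal v⟩
      simp only [Submodule.mem_iInf, LinearMap.mem_ker, map_sub]
      intro y hy
      rw [hv y hy, hLker _ (starProjection_apply_mem _ _) y hy.le, sub_zero]
    · intro w hw
      exact inner_left_of_mem_orthogonal (starProjection_apply_mem L v) (mem_inf.1 hw).2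
  rw [hproj, map_sub, hLker _ (starProjection_apply_mem _ _) x le_rfl, sub_zero]

/-- Suppose that, on Alice's input `x`, the tests `y < x` never succeed and the test `x` succeeds
with weight at least `δ`. Then the component of the state in `firstDetected B x` accounts for this
weight. On Bob's side these components do not depend on Alice's operators, so that by Bessel's
inequality their weights add up to at most that of the shared state `Ψ`, whose rows are indexed by
Alice's basis and are vectors of Bob. -/
theorem card_mul_le_of_tests [Fintype ι] [Fintype S] {R I : Type*} [Fintype R] [Fintype I]
    (A : ι → Matrix R I ℂ) {α β δ : ℝ} (hβ : 0 ≤ β) (hα : 0 ≤ α) (hA : ∀ x, NormSqLE (A x) α)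
    (hB : ∀ y v, ‖B y v‖ ^ 2 ≤ β * ‖v‖ ^ 2) (Ψ : I → EuclideanSpace ℂ J)
    (hzero : ∀ x y, y < x → ∀ r, B y (∑ i, A x r i • Ψ i) = 0)
    (hdiag : ∀ x, δ ≤ ∑ r, ‖B x (∑ i, A x r i • Ψ i)‖ ^ 2) :
    Fintype.card ι * δ ≤ α * β * ∑ i, ‖Ψ i‖ ^ 2 := by
  have hx : ∀ x, δ ≤ α * β * ∑ i, ‖(firstDetected B x).starProjection (Ψ i)‖ ^ 2 := by
    intro x
    calc δ ≤ ∑ r, ‖B x (∑ i, A x r i • Ψ i)‖ ^ 2 := hdiag x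
      _ ≤ ∑ r, β * ‖∑ i, A x r i • (firstDetected B x).starProjection (Ψ i)‖ ^ 2 := by
        refine Finset.sum_le_sum fun r _ => ?_
        rw [← apply_starProjection_firstDetected B fun y hy => hzero x y hy r]
        simpa using hB x ((firstDetected B x).starProjection (∑ i, A x r i • Ψ i))
      _ ≤ β * (α * ∑ i, ‖(firstDetected B x).starProjection (Ψ i)‖ ^ 2) := by
        rw [← Finset.mul_sum]
        exact mul_le_mul_of_nonneg_left ((hA x).sum_norm_sum_smul_sq_le _) hβ
      _ = _ := by ring
  calc Fintype.card ι * δ = ∑ _x : ι, δ := by simp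
    _ ≤ ∑ x, α * β * ∑ i, ‖(firstDetected B x).starProjection (Ψ i)‖ ^ 2 :=
      Finset.sum_le_sum fun x _ => hx x
    _ = α * β * ∑ i, ∑ x, ‖(firstDetected B x).starProjection (Ψ i)‖ ^ 2 := by
      rw [← Finset.mul_sum, Finset.sum_comm]
    _ ≤ _ := by
      refine mul_le_mul_of_nonneg_left (Finset.sum_le_sum fun i _ => ?_) (mul_nonneg hα hβ)
      exact sum_norm_sq_starProjection_firstDetected_le B (Ψ i)

end Identification

/-! ### Replacing communication by post-selection -/

section PostSelection

variable {X : Type*} {Y : Type*}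

theorem sum_basis_succ {M : Type*} [AddCommMonoid M] {n : ℕ} (g : Basis (n + 1) → M) :
    ∑ w, g w = ∑ b : Bool, ∑ v : Basis n, g (Fin.cons b v) := by
  rw [← Fintype.sum_prod_type']
  exact (Fintype.sum_equiv (Fin.consEquiv fun _ => Bool) _ _ fun _ => rfl).symm

variable {R T : Type*} [Fintype R] [Fintype T] {m : ℕ}

/-- The operator of a party that continues with `A`, preceded by the sending of a qubit: `U` is
applied, and the value of the first qubit is guessed to be the new part `b` of the history. -/
noncomputable def sendMatrix (U : QubitUnitary (m + 1)) (A : Matrix R (Basis m × T) ℂ) :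
    Matrix R (Basis (m + 1) × Bool × T) ℂ :=
  fun r p => ∑ u, A r (u, p.2.2) * U.val (Fin.cons p.2.1 u) p.1

/-- The operator of a party that continues with `A`, preceded by the receipt of a qubit: a new
first qubit is put into the basis state `b` given by the new part of the history. -/
def receiveMatrix (A : Matrix R (Basis (m + 1) × T) ℂ) : Matrix R (Basis m × Bool × T) ℂ :=
  fun r p => A r (Fin.cons p.2.1 p.1, p.2.2)

theorem NormSqLE.sendMatrix {A : Matrix R (Basis m × T) ℂ} {α : ℝ} (hα : 0 ≤ α)
    (hA : NormSqLE A α) (U : QubitUnitary (m + 1)) : NormSqLE (sendMatrix U A) (2 * α) := by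
  intro c
  set d : Bool → T → Basis (m + 1) → ℂ := fun b t w => ∑ u, U.val w u * c (u, b, t) with hd
  have h1 : ∀ r, ∑ p, QuantumComm.sendMatrix U A r p * c p =
      ∑ q, A r q * ∑ b, d b q.2 (Fin.cons b q.1) := by
    intro r
    simp only [QuantumComm.sendMatrix, hd, Fintype.sum_prod_type, Finset.sum_mul, Finset.mul_sum]
    calc _ = ∑ b, ∑ t, ∑ w, ∑ u, A r (u, t) * U.val (Fin.cons b u) w * c (w, b, t) := by
          rw [Finset.sum_comm]
          exact Finset.sum_congr rfl fun b _ => Finset.sum_comm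
      _ = ∑ t, ∑ b, ∑ u, ∑ w, A r (u, t) * (U.val (Fin.cons b u) w * c (w, b, t)) := by
          rw [Finset.sum_comm]
          refine Finset.sum_congr rfl fun t _ => Finset.sum_congr rfl fun b _ => ?_
          rw [Finset.sum_comm]
          simp only [mul_assoc]
      _ = _ := by
          rw [Finset.sum_comm (s := (Finset.univ : Finset (Basis m)))]
          exact Finset.sum_congr rfl fun t _ => Finset.sum_comm
  have h2 : ∀ q : Basis m × T, ‖∑ b, d b q.2 (Fin.cons b q.1)‖ ^ 2 ≤
      2 * ∑ b, ‖d b q.2 (Fin.cons b q.1)‖ ^ 2 := by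
    intro q
    simp only [Fintype.sum_bool]
    have := norm_add_le (d true q.2 (Fin.cons true q.1)) (d false q.2 (Fin.cons false q.1))
    have h3 := pow_le_pow_left₀ (norm_nonneg _) this 2
    nlinarith [sq_nonneg (‖d true q.2 (Fin.cons true q.1)‖ - ‖d false q.2 (Fin.cons false q.1)‖)]
  have h3 : ∑ q : Basis m × T, ∑ b, ‖d b q.2 (Fin.cons b q.1)‖ ^ 2 ≤ ∑ p, ‖c p‖ ^ 2 := by
    calc ∑ q : Basis m × T, ∑ b, ‖d b q.2 (Fin.cons b q.1)‖ ^ 2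
        = ∑ b, ∑ t, ∑ u, ‖d b t (Fin.cons b u)‖ ^ 2 := by
          rw [Finset.sum_comm]
          simp only [Fintype.sum_prod_type_right]
      _ ≤ ∑ b, ∑ t, ∑ w, ‖d b t w‖ ^ 2 := by
          refine Finset.sum_le_sum fun b _ => Finset.sum_le_sum fun t _ => ?_
          rw [sum_basis_succ]
          exact Finset.single_le_sum (f := fun b' => ∑ u, ‖d b t (Fin.cons b' u)‖ ^ 2)
            (fun _ _ => by positivity) (Finset.mem_univ b)
      _ = ∑ b, ∑ t, ∑ u, ‖c (u, b, t)‖ ^ 2 := by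
          simp only [hd, sum_norm_sq_unitary]
      _ = _ := by
          simp only [Fintype.sum_prod_type_right (f := fun p : _ × Bool × T => ‖c p‖ ^ 2),
            Fintype.sum_prod_type]
  calc
    _ = ∑ r, ‖∑ q, A r q * ∑ b, d b q.2 (Fin.cons b q.1)‖ ^ 2 := by simp only [h1]
    _ ≤ α * ∑ q : Basis m × T, ‖∑ b, d b q.2 (Fin.cons b q.1)‖ ^ 2 := hA _
    _ ≤ α * ∑ q : Basis m × T, 2 * ∑ b, ‖d b q.2 (Fin.cons b q.1)‖ ^ 2 :=
      mul_le_mul_of_nonneg_left (Finset.sum_le_sum fun q _ => h2 q) hα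
    _ ≤ _ := by
      rw [← Finset.mul_sum]
      nlinarith [mul_le_mul_of_nonneg_left h3 hα]

theorem NormSqLE.receiveMatrix {A : Matrix R (Basis (m + 1) × T) ℂ} {α : ℝ}
    (hA : NormSqLE A α) : NormSqLE (receiveMatrix A) α := by
  intro c
  have h := hA fun p => c (Fin.tail p.1, p.1 0, p.2)
  simp only [Fintype.sum_prod_type, sum_basis_succ, Fin.tail_cons, Fin.cons_zero] at h
  simp only [Fintype.sum_prod_type, QuantumComm.receiveMatrix]
  simpa only [Finset.sum_comm (s := (Finset.univ : Finset Bool))] using h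

/-- A dialogue can be simulated without communication if the parties share a maximally entangled
state, indexed by the possible histories `t : T` of the qubits sent, on top of `ψ`: with local
operators `A x` and `B y`, they reproduce the output probability up to a constant factor.
After normalisation of the operators and of the entangled state, that factor is
`1 / (α * β * |T|)`. -/
theorem Dialogue.exists_postSelection {m n q : ℕ} (D : Dialogue X Y m n q) :
    ∃ (T R S : Type) (_ : Fintype T) (_ : Fintype R) (_ : Fintype S)
      (A : X → Matrix R (Basis m × T) ℂ) (B : Y → Matrix S (Basis n × T) ℂ) (α β : ℝ),
      0 ≤ α ∧ 0 ≤ β ∧ (∀ x, NormSqLE (A x) α) ∧ (∀ y, NormSqLE (B y) β) ∧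
      α * β * Fintype.card T ≤ 4 ^ q ∧
      ∀ x y (ψ : JointVector m n), D.probOne x y ψ =
        ∑ r, ∑ s, ‖∑ t, ∑ u, ∑ v, A x r (u, t) * ψ u v * B y s (v, t)‖ ^ 2 := by
  -- The sender of the last qubit can measure it, so that this qubit needs no history.
  induction D with
  | @aliceLast m n U =>
    refine ⟨Unit, Basis m, Basis n, inferInstance, inferInstance, inferInstance,
      fun x r p => (U x).val (Fin.cons true r) p.1, fun _ s p => if s = p.1 then 1 else 0, 1, 1,
      zero_le_one, zero_le_one, fun x c => ?_, fun y c => ?_, by norm_num, fun x y ψ => ?_⟩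
    · have h := sum_norm_sq_unitary (U x) fun u => c (u, ())
      rw [sum_basis_succ, Fintype.sum_bool] at h
      simp only [Fintype.sum_prod_type, Finset.univ_unique, Finset.sum_singleton, one_mul]
      rw [← h]
      exact le_add_of_nonneg_right (by positivity)
    · simp [Fintype.sum_prod_type]
    · simp [Dialogue.probOne, JointVector.applyAlice]
  | @bobLast m n V =>
    refine ⟨Unit, Basis m, Basis n, inferInstance, inferInstance, inferInstance,
      fun _ s p => if s = p.1 then 1 else 0, fun y r p => (V y).val (Fin.cons true r) p.1, 1, 1,
      zero_le_one, zero_le_one, fun x c => ?_, fun y c => ?_, by norm_num, fun x y ψ => ?_⟩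
    · simp [Fintype.sum_prod_type]
    · have h := sum_norm_sq_unitary (V y) fun u => c (u, ())
      rw [sum_basis_succ, Fintype.sum_bool] at h
      simp only [Fintype.sum_prod_type, Finset.univ_unique, Finset.sum_singleton, one_mul]
      rw [← h]
      exact le_add_of_nonneg_right (by positivity)
    · simp [Dialogue.probOne, JointVector.applyBob, mul_comm]
  | @aliceSends m n q U next ih =>
    obtain ⟨T, R, S, _, _, _, A, B, α, β, hα, hβ, hA, hB, hc, hp⟩ := ih
    refine ⟨Bool × T, R, S, inferInstance, inferInstance, inferInstance,
      fun x => sendMatrix (U x) (A x), fun y => receiveMatrix (B y), 2 * α, β, by positivity, hβ,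
      fun x => (hA x).sendMatrix hα _, fun y => (hB y).receiveMatrix, ?_, fun x y ψ => ?_⟩
    · rw [Fintype.card_prod, Fintype.card_bool, pow_succ]
      push_cast
      linarith
    · rw [Dialogue.probOne, hp]
      refine Finset.sum_congr rfl fun r _ => Finset.sum_congr rfl fun s _ => ?_
      congr 2
      simp only [JointVector.aliceToBob, JointVector.applyAlice, sendMatrix, receiveMatrix,
        sum_basis_succ (n := n), Fintype.sum_prod_type, Fin.cons_zero, Fin.tail_cons,
        Finset.mul_sum, Finset.sum_mul]
      rw [Finset.sum_comm (s := (Finset.univ : Finset Bool))]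
      refine Finset.sum_congr rfl fun t _ => ?_
      rw [Finset.sum_comm]
      refine Finset.sum_congr rfl fun b _ => ?_
      rw [Finset.sum_comm]
      conv_rhs => rw [Finset.sum_comm]
      refine Finset.sum_congr rfl fun v _ => ?_
      rw [Finset.sum_comm]
      exact Finset.sum_congr rfl fun w _ => Finset.sum_congr rfl fun u _ => by ring
  | @bobSends m n q V next ih =>
    obtain ⟨T, R, S, _, _, _, A, B, α, β, hα, hβ, hA, hB, hc, hp⟩ := ih
    refine ⟨Bool × T, R, S, inferInstance, inferInstance, inferInstance,
      fun x => receiveMatrix (A x), fun y => sendMatrix (V y) (B y), α, 2 * β, hα, by positivity,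
      fun x => (hA x).receiveMatrix, fun y => (hB y).sendMatrix hβ _, ?_, fun x y ψ => ?_⟩
    · rw [Fintype.card_prod, Fintype.card_bool, pow_succ]
      push_cast
      linarith
    · rw [Dialogue.probOne, hp]
      refine Finset.sum_congr rfl fun r _ => Finset.sum_congr rfl fun s _ => ?_
      congr 2
      simp only [JointVector.bobToAlice, JointVector.applyBob, sendMatrix, receiveMatrix,
        sum_basis_succ (n := m), Fintype.sum_prod_type, Fin.cons_zero, Fin.tail_cons,
        Finset.mul_sum, Finset.sum_mul]
      rw [Finset.sum_comm (s := (Finset.univ : Finset Bool))]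
      refine Finset.sum_congr rfl fun t _ => Finset.sum_congr rfl fun b _ =>
        Finset.sum_congr rfl fun u _ => ?_
      rw [Finset.sum_comm]
      exact Finset.sum_congr rfl fun w _ => Finset.sum_congr rfl fun v _ => by ring

end PostSelection

/-! ### The lower bound -/

section LowerBound

variable {X : Type*} {Y : Type*}

theorem card_le_of_computesOneSided {f : X × Y → Bool} {F : Finset (X × Y)}
    (hF : IsUpperTriangularOneFoolingSet f F) {q : ℕ} (P : EntangledProtocol X Y q)
    (hP : P.ComputesOneSided f) : (F.card : ℝ) ≤ 2 * 4 ^ q := by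
  classical
  obtain ⟨⟨hone, -⟩, _, hlt⟩ := hF
  obtain ⟨T, R, S, _, _, _, A, B, α, β, hα, hβ, hA, hB, hc, hp⟩ :=
    P.dialogue.exists_postSelection
  -- The starting state together with the (unnormalised) maximally entangled state on `T`.
  let Ψ : Basis P.aliceQubits × T → EuclideanSpace ℂ (Basis P.bobQubits × T) := fun i =>
    WithLp.toLp 2 fun j => if i.2 = j.2 then P.start i.1 j.1 else 0
  let L : {p // p ∈ F} → EuclideanSpace ℂ (Basis P.bobQubits × T) →ₗ[ℂ] EuclideanSpace ℂ S :=
    fun p => Matrix.toLpLin 2 2 (B p.val.2)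
  have hL : ∀ (p p' : {p // p ∈ F}) r s, L p' (∑ i, A p.val.1 r i • Ψ i) s =
      ∑ t, ∑ u, ∑ v, A p.val.1 r (u, t) * P.start u v * B p'.val.2 s (v, t) := by
    intro p p' r s
    simp only [L, Ψ, Matrix.toLpLin_apply, Matrix.mulVec, dotProduct, WithLp.ofLp_sum,
      WithLp.ofLp_smul, Finset.sum_apply, Pi.smul_apply, smul_eq_mul, Fintype.sum_prod_type,
      mul_ite, mul_zero, Finset.sum_ite_eq', Finset.mem_univ, if_true, Finset.mul_sum]
    rw [Finset.sum_comm]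
    refine Finset.sum_congr rfl fun t _ => ?_
    rw [Finset.sum_comm]
    exact Finset.sum_congr rfl fun u _ => Finset.sum_congr rfl fun v _ => by ring
  have hprob : ∀ p p' : {p // p ∈ F}, P.probOne p.val.1 p'.val.2 =
      ∑ r, ‖L p' (∑ i, A p.val.1 r i • Ψ i)‖ ^ 2 := by
    intro p p'
    simp only [EntangledProtocol.probOne, hp, EuclideanSpace.norm_sq_eq, hL]
  have hΨ : ∑ i, ‖Ψ i‖ ^ 2 = Fintype.card T := by
    have h := P.start_normSq
    simp only [JointVector.normSq] at h
    simp only [Ψ, EuclideanSpace.norm_sq_eq, Fintype.sum_prod_type, apply_ite norm, norm_zero,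
      ite_pow, ne_eq, OfNat.ofNat_ne_zero, not_false_eq_true, zero_pow, Finset.sum_ite_eq,
      Finset.mem_univ, if_true]
    rw [Finset.sum_comm]
    simp [h]
  have key := card_mul_le_of_tests L (fun p => A p.val.1) (δ := 1 / 2) hβ hα (fun p => hA _)
    (fun p v => ?_) Ψ (fun p p' hlt' r => ?_) (fun p => ?_)
  · rw [hΨ, Fintype.card_coe] at key
    linarith
  · simpa [EuclideanSpace.norm_sq_eq, L, Matrix.toLpLin_apply, Matrix.mulVec, dotProduct] using
      hB p.val.2 v
  · have h := (hP p.val.1 p'.val.2).1 (hlt p p' hlt')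
    rw [hprob, Finset.sum_eq_zero_iff_of_nonneg fun _ _ => by positivity] at h
    simpa using h r (Finset.mem_univ r)
  · rw [← hprob]
    exact (hP _ _).2 (hone _ p.2)

end LowerBound

end QuantumComm

theorem theorem1 {X : Type*} {Y : Type*} (f : X × Y → Bool) (F : Finset (X × Y)) (N : ℕ)
    (hF : QuantumComm.IsUpperTriangularOneFoolingSet f F) (hN : F.card = N) :
    (((1 / 2 : ℝ) * Real.logb 2 (N : ℝ) - 1 / 2 : ℝ) : EReal) ≤
      ((QuantumComm.oneSidedComplexity f : ENNReal) : EReal) := by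
  rcases Set.eq_empty_or_nonempty {c : ℕ∞ | ∃ (q : ℕ) (P : QuantumComm.EntangledProtocol X Y q),
    P.ComputesOneSided f ∧ c = q} with h | h
  · rw [QuantumComm.oneSidedComplexity, h, sInf_empty]
    simp
  obtain ⟨q, P, hP, hq⟩ := csInf_mem h
  rw [QuantumComm.oneSidedComplexity, hq]
  have hcard := QuantumComm.card_le_of_computesOneSided hF P hP
  rw [hN] at hcard
  have hlog : Real.logb 2 (N : ℝ) ≤ 2 * q + 1 := by
    rcases N.eq_zero_or_pos with rfl | hpos
    · simp
      positivity
    · rw [Real.logb_le_iff_le_rpow one_lt_two (by exact_mod_cast hpos)]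
      refine hcard.trans_eq ?_
      rw [show (2 * q + 1 : ℝ) = ((2 * q + 1 : ℕ) : ℝ) by push_cast; ring, Real.rpow_natCast,
        pow_succ, pow_mul]
      norm_num [mul_comm]
  have hreal : (1 / 2 : ℝ) * Real.logb 2 (N : ℝ) - 1 / 2 ≤ (q : ℝ) := by linarith
  have hcast : ((((q : ℕ∞) : ENNReal)) : EReal) = ((q : ℝ) : EReal) := by
    rw [ENat.toENNReal_coe, ← ENNReal.ofReal_natCast, EReal.coe_ennreal_ofReal,
      max_eq_left q.cast_nonneg]
  rw [hcast]
  exact_mod_cast hreal
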